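/- All groups are finite. Let $G$ be a soluble group. The nilpotent length of a group $H$ is the least $n\ge 0$ for which $H$ has a series $1=H_0\le H_1\le\dots\le H_n=H$ of normal subgroups with all factors $H_{i+1}/H_i$ nilpotent. For $k\ge 0$ let $\mathcal N^k$ be the set of all subgroups of $G$ of nilpotent length at most $k$. A nonempty set $\mathcal F$ of subgroups of $G$ is a Fitting set of $G$ if (i) $T\trianglelefteq S\in\mathcal F$ implies $T\in\mathcal F$; (ii) $S,T\in\mathcal F$, $S\trianglelefteq ST$ and $T\trianglelefteq ST$ imply $ST\in\mathcal F$; (iii) $S\in\mathcal F$ and $x\in G$ imply $S^x\in\mathcal F$. For a set $\mathcal F$ of subgroups of $G$, the radical $G_{\mathcal F}$ is the product of all normal subgroups of $G$ belonging to $\mathcal F$, and a subgroup $V\le G$ is an $\mathcal F$-injector of $G$ if, for every subnormal subgroup $K$ of $G$, $V\cap K$ is maximal (under inclusion) among the subgroups of $K$ belonging to $\mathcal F$. A nilpotent injector of a group is an injector for the set of all its nilpotent subgroups, and $F(G)$ is the Fitting subgroup, the product of all normal nilpotent subgroups of $G$. For every $k\ge 1$, $\mathcal N^k$ is a Fitting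 set of $G$, and the set of all $\mathcal N^k$-injectors of $G$ is exactly the set of all subgroups $V$ of $G$ such that $G_{\mathcal N^{k-1}}\le V$ and $V/G_{\mathcal N^{k-1}}$ is a nilpotent injector of $G/G_{\mathcal N^{k-1}}$. In particular, a subgroup $V$ of $G$ is an $\mathcal N^2$-injector of $G$ if and only if $F(G)\le V$ and $V/F(G)$ is a nilpotent injector of $G/F(G)$. -/

import Mathlib

namespace FittingTheory

/-- `G` has a normal series `1 = H 0 ≤ H 1 ≤ ⋯ ≤ H n = G` of length `n`, all of whose terms are
normal in `G` and all of whose factors `H (i + 1) / H i` are nilpotent. (By monotonicity the terms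
`H i` with `n ≤ i` are all equal to `G`.) -/
def HasNilpotentSeries (G : Type*) [Group G] (n : ℕ) : Prop :=
  ∃ (H : ℕ → Subgroup G) (_ : ∀ i, (H i).Normal),
    Monotone H ∧ H 0 = ⊥ ∧ H n = ⊤ ∧
      ∀ i, Group.IsNilpotent (↥(H (i + 1)) ⧸ (H i).subgroupOf (H (i + 1)))

/-- The nilpotent length (Fitting length) of a group: the least length of a normal series with
nilpotent factors, and `⊤` if there is no such series. -/
noncomputable def nilpotentLength (G : Type*) [Group G] : ℕ∞ :=
  ⨅ (n : ℕ) (_ : HasNilpotentSeries G n), (n : ℕ∞)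

variable {G : Type*} [Group G]

/-- A Fitting set of `G`. In `mul_mem`, as `S` is normal in `S ⊔ T`, the join `S ⊔ T` is the
product `ST`. -/
structure IsFittingSet (F : Set (Subgroup G)) : Prop where
  nonempty : F.Nonempty
  normal_mem : ∀ S T : Subgroup G, S ∈ F → T ≤ S → (T.subgroupOf S).Normal → T ∈ F
  mul_mem : ∀ S T : Subgroup G, S ∈ F → T ∈ F →
    (S.subgroupOf (S ⊔ T)).Normal → (T.subgroupOf (S ⊔ T)).Normal → S ⊔ T ∈ F
  conj_mem : ∀ (S : Subgroup G) (x : G), S ∈ F → S.map (MulAut.conj x).toMonoidHom ∈ F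

/-- The `F`-radical of `G`: the product of all normal subgroups of `G` that belong to `F`. -/
def radical (F : Set (Subgroup G)) : Subgroup G :=
  sSup {N : Subgroup G | N.Normal ∧ N ∈ F}

instance radical_normal (F : Set (Subgroup G)) : (radical F).Normal :=
  Subgroup.sSup_normal _ fun _ hN => hN.1

/-- `V` is an `F`-injector of `G`: for every subnormal subgroup `K` of `G`, the intersection
`V ⊓ K` is maximal among the subgroups of `K` that belong to `F`. -/
def IsInjector (F : Set (Subgroup G)) (V : Subgroup G) : Prop :=
  ∀ K : Subgroup G, K.IsSubnormal → Maximal (fun U : Subgroup G => U ≤ K ∧ U ∈ F) (V ⊓ K)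

variable (G)

/-- The set of all nilpotent subgroups of `G`. -/
def nilpotentSubgroups : Set (Subgroup G) :=
  {H | Group.IsNilpotent H}

/-- The set `𝒩ᵏ` of all subgroups of `G` of nilpotent length at most `k`. -/
def nilpotentLengthLE (k : ℕ) : Set (Subgroup G) :=
  {H | nilpotentLength H ≤ k}

/-- The Fitting subgroup `F(G)`: the product of all normal nilpotent subgroups of `G`. -/
def fittingSubgroup : Subgroup G :=
  radical (nilpotentSubgroups G)

instance fittingSubgroup_normal : (fittingSubgroup G).Normal :=
  radical_normal _

variable {G}

/-- `V` contains the normal subgroup `R`, and `V / R` is a nilpotent injector of `G / R`. -/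
def IsNilpotentInjectorMod (R : Subgroup G) [R.Normal] (V : Subgroup G) : Prop :=
  R ≤ V ∧ IsInjector (nilpotentSubgroups (G ⧸ R)) (V.map (QuotientGroup.mk' R))

end FittingTheory

/-! Nilpotent length at most `k` means that the `k`-fold iterate of the nilpotent residual is
trivial, so closure properties become inequalities between residuals (`nilpotentResidual_sup_le` for
products). Let R ≤ S be the radicals for lengths k and k + 1. The crux,
`nilpotentResidual_le_radical_of_radical_le`, is that a subgroup W ≥ S of length at most k + 1 has
nilpotent image mod R. It rests on solubility, through the self-centralizing property
`le_radical_of_commutator_le`. Conversely, any subgroup with nilpotent image mod R has length at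
most k + 1. Both kinds of injector contain S, so maximality transfers along G → G/R, with the crux
relativized to each subnormal subgroup. -/

namespace FittingTheory

open Subgroup

/-! ### Nilpotent residuals and their iterates -/

section Residual

variable {G : Type*} [Group G]

/-- The nilpotent residual of a subgroup `H` of `G`: the intersection of the terms of its lower
central series. -/
def nilpotentResidual (H : Subgroup G) : Subgroup G :=
  ⨅ n, H.lowerCentralSeries n

theorem nilpotentResidual_le_lowerCentralSeries (H : Subgroup G) (n : ℕ) :
    nilpotentResidual H ≤ H.lowerCentralSeries n :=
  iInf_le _ n

theorem nilpotentResidual_le (H : Subgroup G) : nilpotentResidual H ≤ H :=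
  nilpotentResidual_le_lowerCentralSeries H 0

theorem nilpotentResidual_mono : Monotone (nilpotentResidual (G := G)) :=
  fun _ _ h => iInf_mono fun n => lowerCentralSeries_mono n h

theorem nilpotentResidual_iterate_mono (k : ℕ) : Monotone (nilpotentResidual (G := G))^[k] :=
  nilpotentResidual_mono.iterate k

theorem nilpotentResidual_iterate_le (H : Subgroup G) (k : ℕ) : nilpotentResidual^[k] H ≤ H := by
  induction k with
  | zero => exact le_rfl
  | succ k ih =>
    rw [Function.iterate_succ_apply']
    exact (nilpotentResidual_le _).trans ih

theorem nilpotentResidual_iterate_bot (k : ℕ) :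
    nilpotentResidual^[k] (⊥ : Subgroup G) = ⊥ :=
  le_bot_iff.mp (nilpotentResidual_iterate_le ⊥ k)

theorem nilpotentResidual_iterate_eq_bot_of_le {H : Subgroup G} {m n : ℕ} (hmn : m ≤ n)
    (h : nilpotentResidual^[m] H = ⊥) : nilpotentResidual^[n] H = ⊥ := by
  obtain ⟨d, rfl⟩ := Nat.exists_eq_add_of_le hmn
  rw [add_comm, Function.iterate_add_apply, h, nilpotentResidual_iterate_bot]

variable [Finite G]

/-- Descending chains stabilize in a finite group. The residual is thus an actual term of the
series, which is what makes it commute with homomorphisms. -/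
theorem exists_forall_lowerCentralSeries_eq_nilpotentResidual (H : Subgroup G) :
    ∃ n, ∀ m, n ≤ m → H.lowerCentralSeries m = nilpotentResidual H := by
  obtain ⟨n, hn⟩ := WellFoundedGT.monotone_chain_condition
    (α := (Subgroup G)ᵒᵈ) ⟨H.lowerCentralSeries, fun _ _ h => H.lowerCentralSeries_antitone h⟩
  have hn : ∀ m, n ≤ m → H.lowerCentralSeries n = H.lowerCentralSeries m := hn
  have key : H.lowerCentralSeries n = nilpotentResidual H := by
    refine le_antisymm (le_iInf fun m => ?_) (nilpotentResidual_le_lowerCentralSeries H n)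
    rcases le_total n m with h | h
    · exact (hn m h).le
    · exact H.lowerCentralSeries_antitone h
  exact ⟨n, fun m hm => (hn m hm).symm.trans key⟩

theorem nilpotentResidual_le_iff {H N : Subgroup G} :
    nilpotentResidual H ≤ N ↔ ∃ n, H.lowerCentralSeries n ≤ N := by
  refine ⟨fun h => ?_, fun ⟨n, hn⟩ => (nilpotentResidual_le_lowerCentralSeries H n).trans hn⟩
  obtain ⟨n, hn⟩ := exists_forall_lowerCentralSeries_eq_nilpotentResidual H
  exact ⟨n, (hn n le_rfl).le.trans h⟩

theorem map_nilpotentResidual {K : Type*} [Group K] (f : G →* K) (H : Subgroup G) :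
    (nilpotentResidual H).map f = nilpotentResidual (H.map f) := by
  apply le_antisymm
  · refine le_iInf fun n => ?_
    rw [← map_lowerCentralSeries]
    exact map_mono (nilpotentResidual_le_lowerCentralSeries H n)
  · obtain ⟨n, hn⟩ := exists_forall_lowerCentralSeries_eq_nilpotentResidual H
    rw [← hn n le_rfl, map_lowerCentralSeries]
    exact nilpotentResidual_le_lowerCentralSeries _ n

theorem map_nilpotentResidual_iterate {K : Type*} [Group K] [Finite K] (f : G →* K)
    (H : Subgroup G) (k : ℕ) :
    (nilpotentResidual^[k] H).map f = nilpotentResidual^[k] (H.map f) := by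
  induction k with
  | zero => rfl
  | succ k ih => simp only [Function.iterate_succ_apply', map_nilpotentResidual, ih]

theorem isNilpotent_iff_nilpotentResidual_eq_bot (H : Subgroup G) :
    Group.IsNilpotent H ↔ nilpotentResidual H = ⊥ := by
  simp only [isNilpotent_iff_lowerCentralSeries, ← le_bot_iff, nilpotentResidual_le_iff]

theorem normalizer_le_normalizer_nilpotentResidual_iterate (H : Subgroup G) (k : ℕ) :
    normalizer (H : Set G) ≤ normalizer (nilpotentResidual^[k] H : Subgroup G) := by
  intro g hg
  rw [mem_normalizer_iff_map_conj_eq] at hg ⊢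
  refine (map_nilpotentResidual_iterate (MulAut.conj g).toMonoidHom H k).trans ?_
  exact congrArg _ hg

theorem normal_nilpotentResidual_iterate (H : Subgroup G) [hH : H.Normal] (k : ℕ) :
    (nilpotentResidual^[k] H).Normal := by
  rw [← normalizer_eq_top_iff, ← top_le_iff]
  refine le_trans ?_ (normalizer_le_normalizer_nilpotentResidual_iterate H k)
  rw [top_le_iff, normalizer_eq_top_iff]
  exact hH

instance normal_nilpotentResidual (H : Subgroup G) [H.Normal] : (nilpotentResidual H).Normal :=
  normal_nilpotentResidual_iterate H 1

end Residual

/-! ### Fitting's theorem for residuals -/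

section Commutator

variable {G : Type*} [Group G]

theorem commutator_le_iff_le_comap_centralizer {X Y N : Subgroup G} [N.Normal] :
    ⁅X, Y⁆ ≤ N ↔
      X ≤ (centralizer (Y.map (QuotientGroup.mk' N) : Set (G ⧸ N))).comap
        (QuotientGroup.mk' N) := by
  rw [← map_le_iff_le_comap, ← commutator_eq_bot_iff_le_centralizer, ← map_commutator,
    Subgroup.map_eq_bot_iff, QuotientGroup.ker_mk']

theorem commutator_sup_right_le {X Y Z N : Subgroup G} [N.Normal] (hY : ⁅X, Y⁆ ≤ N)
    (hZ : ⁅X, Z⁆ ≤ N) : ⁅X, Y ⊔ Z⁆ ≤ N := by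
  rw [commutator_comm, commutator_le_iff_le_comap_centralizer] at *
  exact sup_le hY hZ

theorem commutator_iSup_left_le {ι : Sort*} {X : ι → Subgroup G} {Y N : Subgroup G} [N.Normal]
    (h : ∀ i, ⁅X i, Y⁆ ≤ N) : ⁅⨆ i, X i, Y⁆ ≤ N := by
  simp only [commutator_le_iff_le_comap_centralizer] at *
  exact iSup_le h

/-- The lower central series of `A`, shifted by one and preceded by the whole group. -/
def shiftedLowerCentralSeries (A : Subgroup G) : ℕ → Subgroup G
  | 0 => ⊤
  | n + 1 => A.lowerCentralSeries n

instance shiftedLowerCentralSeries_normal (A : Subgroup G) [A.Normal] (n : ℕ) :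
    (shiftedLowerCentralSeries A n).Normal := by
  cases n with
  | zero => exact inferInstanceAs (⊤ : Subgroup G).Normal
  | succ n => exact inferInstanceAs (A.lowerCentralSeries n).Normal

theorem commutator_shiftedLowerCentralSeries_le (A : Subgroup G) [A.Normal] (n : ℕ) :
    ⁅shiftedLowerCentralSeries A n, A⁆ ≤ shiftedLowerCentralSeries A (n + 1) := by
  cases n with
  | zero => exact commutator_le_right _ _
  | succ n => exact le_rfl

/-- Commuting with `A` or with `B` raises the corresponding index by one, while normality keeps the
commutator inside the other term. -/
theorem lowerCentralSeries_sup_le (A B : Subgroup G) [A.Normal] [B.Normal] (m : ℕ) :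
    (A ⊔ B).lowerCentralSeries m ≤
      ⨆ p : {p : ℕ × ℕ // p.1 + p.2 = m + 1},
        shiftedLowerCentralSeries A p.1.1 ⊓ shiftedLowerCentralSeries B p.1.2 := by
  induction m with
  | zero =>
    apply sup_le
    · exact le_iSup_of_le ⟨(1, 0), rfl⟩ (le_inf le_rfl le_top)
    · exact le_iSup_of_le ⟨(0, 1), rfl⟩ (le_inf le_top le_rfl)
  | succ m ih =>
    refine (commutator_mono ih le_rfl).trans (commutator_iSup_left_le ?_)
    rintro ⟨⟨i, j⟩, hij : i + j = m + 1⟩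
    apply commutator_sup_right_le
    · refine le_iSup_of_le ⟨(i + 1, j), by simp only; omega⟩ (le_inf ?_ ?_)
      · exact (commutator_mono inf_le_left le_rfl).trans
          (commutator_shiftedLowerCentralSeries_le A i)
      · exact (commutator_mono inf_le_right le_rfl).trans (commutator_le_left _ _)
    · refine le_iSup_of_le ⟨(i, j + 1), by simp only; omega⟩ (le_inf ?_ ?_)
      · exact (commutator_mono inf_le_left le_rfl).trans (commutator_le_left _ _)
      · exact (commutator_mono inf_le_right le_rfl).trans
          (commutator_shiftedLowerCentralSeries_le B j)

variable [Finite G]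

/-- A quantitative form of Fitting's theorem. -/
theorem nilpotentResidual_sup_le (A B : Subgroup G) [A.Normal] [B.Normal] :
    nilpotentResidual (A ⊔ B) ≤ nilpotentResidual A ⊔ nilpotentResidual B := by
  obtain ⟨p, hp⟩ := exists_forall_lowerCentralSeries_eq_nilpotentResidual A
  obtain ⟨q, hq⟩ := exists_forall_lowerCentralSeries_eq_nilpotentResidual B
  -- The shifted indices sum to `p + q + 2`, so one of them exceeds `p` or the other exceeds `q`;
  -- there the series has already stabilized.
  refine nilpotentResidual_le_iff.mpr ⟨p + q + 1, (lowerCentralSeries_sup_le A B _).trans ?_⟩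
  refine iSup_le ?_
  rintro ⟨⟨i, j⟩, hij : i + j = p + q + 1 + 1⟩
  rcases Nat.lt_or_ge p i with h | h
  · obtain ⟨i, rfl⟩ := Nat.exists_eq_succ_of_ne_zero (Nat.ne_zero_of_lt h)
    exact inf_le_left.trans ((hp i (by omega)).le.trans le_sup_left)
  · obtain ⟨j, rfl⟩ : ∃ n, j = n + 1 := Nat.exists_eq_succ_of_ne_zero (by omega)
    exact inf_le_right.trans ((hq j (by omega)).le.trans le_sup_right)

theorem nilpotentResidual_iterate_sup_le (A B : Subgroup G) [A.Normal] [B.Normal] (k : ℕ) :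
    nilpotentResidual^[k] (A ⊔ B) ≤ nilpotentResidual^[k] A ⊔ nilpotentResidual^[k] B := by
  induction k with
  | zero => exact le_rfl
  | succ k ih =>
    have := normal_nilpotentResidual_iterate A k
    have := normal_nilpotentResidual_iterate B k
    simp only [Function.iterate_succ_apply']
    exact (nilpotentResidual_mono ih).trans (nilpotentResidual_sup_le _ _)

theorem nilpotentResidual_iterate_sup_eq_bot {A B : Subgroup G} {k : ℕ}
    (hAB : A ≤ normalizer (B : Set G)) (hBA : B ≤ normalizer (A : Set G))
    (hA : nilpotentResidual^[k] A = ⊥) (hB : nilpotentResidual^[k] B = ⊥) :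
    nilpotentResidual^[k] (A ⊔ B) = ⊥ := by
  have hAn : (A.subgroupOf (A ⊔ B)).Normal :=
    (normal_subgroupOf_iff_le_normalizer le_sup_left).mpr (sup_le le_normalizer hBA)
  have hBn : (B.subgroupOf (A ⊔ B)).Normal :=
    (normal_subgroupOf_iff_le_normalizer le_sup_right).mpr (sup_le hAB le_normalizer)
  have key := map_mono (f := (A ⊔ B).subtype) (nilpotentResidual_iterate_sup_le
    (A.subgroupOf (A ⊔ B)) (B.subgroupOf (A ⊔ B)) k)
  rw [Subgroup.map_sup] at key
  simp only [map_nilpotentResidual_iterate] at key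
  rw [Subgroup.map_sup, map_subgroupOf_eq_of_le le_sup_left, map_subgroupOf_eq_of_le le_sup_right, hA, hB,
    sup_bot_eq] at key
  exact le_bot_iff.mp key

end Commutator

/-! ### Nilpotent length via iterated residuals -/

section Length

variable {G : Type*} [Group G] [Finite G]

theorem isNilpotent_quotient_subgroupOf_iff (A B : Subgroup G) [B.Normal] :
    Group.IsNilpotent (A ⧸ B.subgroupOf A) ↔ nilpotentResidual A ≤ B := by
  rw [← Group.isNilpotent_top, isNilpotent_iff_nilpotentResidual_eq_bot,
    ← map_top_of_surjective _ (QuotientGroup.mk'_surjective (B.subgroupOf A)),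
    ← map_nilpotentResidual, Subgroup.map_eq_bot_iff, QuotientGroup.ker_mk', ← map_subtype_le_map_subtype,
    map_nilpotentResidual, ← MonoidHom.range_eq_map, range_subtype, subgroupOf_map_subtype,
    le_inf_iff, and_iff_left (nilpotentResidual_le A)]

/-- The iterated residuals form the fastest descending series with nilpotent factors: they lie below
any other one, read from the top. -/
theorem hasNilpotentSeries_iff (k : ℕ) :
    HasNilpotentSeries G k ↔ nilpotentResidual^[k] (⊤ : Subgroup G) = ⊥ := by
  constructor
  · rintro ⟨H, hn, -, h0, hk, hnil⟩
    have key : ∀ j, j ≤ k → nilpotentResidual^[j] (⊤ : Subgroup G) ≤ H (k - j) := by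
      intro j
      induction j with
      | zero => exact fun _ => hk.ge
      | succ j ih =>
        intro hj
        have hs : k - j = k - (j + 1) + 1 := by omega
        have := hn (k - (j + 1))
        rw [Function.iterate_succ_apply']
        refine (nilpotentResidual_mono (ih (by omega))).trans ?_
        rw [hs]
        exact (isNilpotent_quotient_subgroupOf_iff _ _).mp (hnil _)
    have := key k le_rfl
    rwa [Nat.sub_self, h0, le_bot_iff] at this
  · intro h
    have hn (i : ℕ) : (nilpotentResidual^[k - i] (⊤ : Subgroup G)).Normal :=
      normal_nilpotentResidual_iterate ⊤ _
    have hstep (j : ℕ) : nilpotentResidual (nilpotentResidual^[k - (j + 1)] (⊤ : Subgroup G)) ≤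
        nilpotentResidual^[k - j] ⊤ := by
      rcases Nat.lt_or_ge j k with hj | hj
      · have hs : k - j = k - (j + 1) + 1 := by omega
        rw [hs, Function.iterate_succ_apply']
      · rw [Nat.sub_eq_zero_of_le hj]
        exact le_top
    -- Truncated subtraction makes the series constantly `⊤` from index `k` on.
    refine ⟨fun i => nilpotentResidual^[k - i] ⊤, hn, monotone_nat_of_le_succ fun i => ?_, h, ?_,
      fun i => ?_⟩
    · rcases Nat.lt_or_ge i k with hi | hi
      · have hs : k - i = k - (i + 1) + 1 := by omega
        rw [hs, Function.iterate_succ_apply']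
        exact nilpotentResidual_le _
      · rw [Nat.sub_eq_zero_of_le (hi.trans i.le_succ)]
        exact le_top
    · simp
    · exact (isNilpotent_quotient_subgroupOf_iff _ _).mpr (hstep i)

theorem nilpotentLength_le_iff (k : ℕ) :
    nilpotentLength G ≤ k ↔ nilpotentResidual^[k] (⊤ : Subgroup G) = ⊥ := by
  constructor
  · intro h
    by_contra hk
    have hle : ((k + 1 : ℕ) : ℕ∞) ≤ nilpotentLength G := by
      refine le_iInf₂ fun n hn => ?_
      rw [hasNilpotentSeries_iff] at hn
      rw [Nat.cast_le]
      by_contra hlt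
      exact hk (nilpotentResidual_iterate_eq_bot_of_le (by omega) hn)
    have := hle.trans h
    rw [Nat.cast_le] at this
    omega
  · exact fun h => iInf₂_le k ((hasNilpotentSeries_iff k).mpr h)

theorem mem_nilpotentLengthLE_iff {H : Subgroup G} {k : ℕ} :
    H ∈ nilpotentLengthLE G k ↔ nilpotentResidual^[k] H = ⊥ := by
  rw [nilpotentLengthLE, Set.mem_ofPred_eq, nilpotentLength_le_iff, ← map_subtype_inj (H := H),
    map_nilpotentResidual_iterate, ← MonoidHom.range_eq_map, range_subtype, Subgroup.map_bot]

theorem nilpotentLengthLE_one : nilpotentLengthLE G 1 = nilpotentSubgroups G := by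
  ext H
  rw [mem_nilpotentLengthLE_iff]
  exact (isNilpotent_iff_nilpotentResidual_eq_bot H).symm

theorem mem_nilpotentLengthLE_of_le {H K : Subgroup G} {k : ℕ} (hHK : H ≤ K)
    (hK : K ∈ nilpotentLengthLE G k) : H ∈ nilpotentLengthLE G k := by
  rw [mem_nilpotentLengthLE_iff] at *
  exact le_bot_iff.mp ((nilpotentResidual_iterate_mono k hHK).trans hK.le)

theorem sup_mem_nilpotentLengthLE {A B : Subgroup G} {k : ℕ}
    (hAB : A ≤ normalizer (B : Set G)) (hBA : B ≤ normalizer (A : Set G))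
    (hA : A ∈ nilpotentLengthLE G k) (hB : B ∈ nilpotentLengthLE G k) :
    A ⊔ B ∈ nilpotentLengthLE G k := by
  rw [mem_nilpotentLengthLE_iff] at *
  exact nilpotentResidual_iterate_sup_eq_bot hAB hBA hA hB

theorem map_mem_nilpotentLengthLE {K : Type*} [Group K] [Finite K] (f : G →* K) {H : Subgroup G}
    {k : ℕ} (hH : H ∈ nilpotentLengthLE G k) : H.map f ∈ nilpotentLengthLE K k := by
  rw [mem_nilpotentLengthLE_iff] at *
  rw [← map_nilpotentResidual_iterate, hH, Subgroup.map_bot]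

theorem bot_mem_nilpotentLengthLE (k : ℕ) : ⊥ ∈ nilpotentLengthLE G k :=
  mem_nilpotentLengthLE_iff.mpr (nilpotentResidual_iterate_bot k)

theorem mem_nilpotentLengthLE_succ {H N : Subgroup G} {k : ℕ} (hN : N ∈ nilpotentLengthLE G k)
    (h : nilpotentResidual H ≤ N) : H ∈ nilpotentLengthLE G (k + 1) := by
  rw [mem_nilpotentLengthLE_iff, Function.iterate_succ_apply, ← mem_nilpotentLengthLE_iff]
  exact mem_nilpotentLengthLE_of_le h hN

theorem nilpotentResidual_mem_nilpotentLengthLE {H : Subgroup G} {k : ℕ}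
    (hH : H ∈ nilpotentLengthLE G (k + 1)) : nilpotentResidual H ∈ nilpotentLengthLE G k := by
  rw [mem_nilpotentLengthLE_iff] at *
  rwa [Function.iterate_succ_apply] at hH

theorem isFittingSet_nilpotentLengthLE (k : ℕ) : IsFittingSet (nilpotentLengthLE G k) where
  nonempty := ⟨⊥, bot_mem_nilpotentLengthLE k⟩
  normal_mem _ _ hS hTS _ := mem_nilpotentLengthLE_of_le hTS hS
  mul_mem S T hS hT hSn hTn := by
    rw [normal_subgroupOf_iff_le_normalizer le_sup_left] at hSn
    rw [normal_subgroupOf_iff_le_normalizer le_sup_right] at hTn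
    exact sup_mem_nilpotentLengthLE (le_sup_left.trans hTn) (le_sup_right.trans hSn) hS hT
  conj_mem _ _ hS := map_mem_nilpotentLengthLE _ hS

end Length

/-! ### Radicals of subnormal subgroups -/

section Radical

variable {G : Type*} [Group G] [Finite G]

/-- The product of all normal subgroups of `H` of nilpotent length at most `k`, as a subgroup
of `G`. -/
def relativeRadical (k : ℕ) (H : Subgroup G) : Subgroup G :=
  sSup {X | X ≤ H ∧ H ≤ normalizer (X : Set G) ∧ X ∈ nilpotentLengthLE G k}

omit [Finite G] in
theorem le_relativeRadical {k : ℕ} {H X : Subgroup G} (hXH : X ≤ H)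
    (hHX : H ≤ normalizer (X : Set G)) (hX : X ∈ nilpotentLengthLE G k) :
    X ≤ relativeRadical k H :=
  le_sSup ⟨hXH, hHX, hX⟩

omit [Finite G] in
theorem le_normalizer_sup {H A B : Subgroup G} (hA : H ≤ normalizer (A : Set G))
    (hB : H ≤ normalizer (B : Set G)) : H ≤ normalizer ((A ⊔ B : Subgroup G) : Set G) := by
  intro g hg
  have h1 := hA hg
  have h2 := hB hg
  rw [mem_normalizer_iff_map_conj_eq] at *
  refine (Subgroup.map_sup A B _).trans ?_
  exact congrArg₂ _ h1 h2

theorem relativeRadical_spec (k : ℕ) (H : Subgroup G) :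
    relativeRadical k H ≤ H ∧ H ≤ normalizer (relativeRadical k H : Set G) ∧
      relativeRadical k H ∈ nilpotentLengthLE G k := by
  refine SupClosed.sSup_mem
    (s := {X : Subgroup G | X ≤ H ∧ H ≤ normalizer (X : Set G) ∧ X ∈ nilpotentLengthLE G k})
    ?_ (Set.toFinite _) ?_ le_rfl
  · rintro A ⟨hA1, hA2, hA3⟩ B ⟨hB1, hB2, hB3⟩
    exact ⟨sup_le hA1 hB1, le_normalizer_sup hA2 hB2,
      sup_mem_nilpotentLengthLE (hA1.trans hB2) (hB1.trans hA2) hA3 hB3⟩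
  · refine ⟨bot_le, ?_, bot_mem_nilpotentLengthLE k⟩
    rw [normalizer_eq_top_iff.mpr inferInstance]
    exact le_top

omit [Finite G] in
theorem relativeRadical_top (k : ℕ) :
    relativeRadical k (⊤ : Subgroup G) = radical (nilpotentLengthLE G k) := by
  simp only [relativeRadical, radical, le_top, top_le_iff, normalizer_eq_top_iff, true_and]

theorem radical_mem_nilpotentLengthLE (k : ℕ) :
    radical (nilpotentLengthLE G k) ∈ nilpotentLengthLE G k := by
  rw [← relativeRadical_top]
  exact (relativeRadical_spec k ⊤).2.2

omit [Finite G] in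
theorem le_radical {F : Set (Subgroup G)} {N : Subgroup G} [hn : N.Normal] (hN : N ∈ F) :
    N ≤ radical F :=
  le_sSup ⟨hn, hN⟩

theorem normalizer_le_normalizer_relativeRadical (k : ℕ) (H : Subgroup G) :
    normalizer (H : Set G) ≤ normalizer (relativeRadical k H : Set G) := by
  rw [le_set_normalizer_iff]
  intro g hg x hx
  obtain ⟨h1, h2, h3⟩ := relativeRadical_spec k H
  have hH : H.map (MulAut.conj g).toMonoidHom = H := mem_normalizer_iff_map_conj_eq.mp hg
  have hle : (relativeRadical k H).map (MulAut.conj g).toMonoidHom ≤ relativeRadical k H := by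
    refine le_relativeRadical ?_ ?_ (map_mem_nilpotentLengthLE _ h3)
    · exact (map_mono h1).trans hH.le
    · exact hH.ge.trans ((map_mono h2).trans (le_normalizer_map _))
  exact hle ⟨x, hx, rfl⟩

/-- Radicals of subnormal subgroups are contained in the radical. -/
theorem relativeRadical_le_radical (k : ℕ) {K : Subgroup G} (hK : K.IsSubnormal) :
    relativeRadical k K ≤ radical (nilpotentLengthLE G k) := by
  induction hK with
  | top => exact (relativeRadical_top k).le
  | step H K hle _ hn ih =>
    rw [normal_subgroupOf_iff_le_normalizer hle] at hn
    obtain ⟨h1, -, h3⟩ := relativeRadical_spec k H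
    refine (le_relativeRadical (h1.trans hle) ?_ h3).trans ih
    exact hn.trans (normalizer_le_normalizer_relativeRadical k H)

theorem le_radical_of_isSubnormal {k : ℕ} {K X : Subgroup G} (hK : K.IsSubnormal) (hXK : X ≤ K)
    (hKX : K ≤ normalizer (X : Set G)) (hX : X ∈ nilpotentLengthLE G k) :
    X ≤ radical (nilpotentLengthLE G k) :=
  (le_relativeRadical hXK hKX hX).trans (relativeRadical_le_radical k hK)

theorem map_subtype_radical_le (k : ℕ) {K : Subgroup G} (hK : K.IsSubnormal) :
    (radical (nilpotentLengthLE K k)).map K.subtype ≤ radical (nilpotentLengthLE G k) := by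
  refine le_radical_of_isSubnormal hK (map_subtype_le _) ?_
    (map_mem_nilpotentLengthLE _ (radical_mem_nilpotentLengthLE k))
  rw [← normal_subgroupOf_iff_le_normalizer (map_subtype_le _)]
  change (((radical (nilpotentLengthLE K k)).map K.subtype).comap K.subtype).Normal
  rw [comap_map_eq_self_of_injective K.subtype_injective]
  infer_instance

theorem nilpotentResidual_radical_le (k : ℕ) :
    nilpotentResidual (radical (nilpotentLengthLE G (k + 1))) ≤ radical (nilpotentLengthLE G k) :=
  le_radical (nilpotentResidual_mem_nilpotentLengthLE (radical_mem_nilpotentLengthLE _))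

theorem radical_le_radical_succ (k : ℕ) :
    radical (nilpotentLengthLE G k) ≤ radical (nilpotentLengthLE G (k + 1)) :=
  le_radical (mem_nilpotentLengthLE_succ (radical_mem_nilpotentLengthLE k) (nilpotentResidual_le _))

end Radical

/-! ### Self-centralization in soluble groups -/

section Soluble

variable {G : Type*} [Group G] [Finite G] [Group.IsSolvable G]

/-- In a soluble group, the upper nilpotent series is self-centralizing: everything that
centralizes the factor `G_{k+1} / G_k` of radicals lies in `G_{k+1}`. -/
theorem le_radical_of_commutator_le {k : ℕ} {X : Subgroup G}
    (hX : ⁅X, radical (nilpotentLengthLE G (k + 1))⁆ ≤ radical (nilpotentLengthLE G k)) :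
    X ≤ radical (nilpotentLengthLE G (k + 1)) := by
  set R := radical (nilpotentLengthLE G k)
  set S := radical (nilpotentLengthLE G (k + 1)) with hS
  have : R.Normal := radical_normal _
  have : S.Normal := radical_normal _
  set C := (centralizer (S.map (QuotientGroup.mk' R) : Set (G ⧸ R))).comap (QuotientGroup.mk' R)
    with hC
  have : (S.map (QuotientGroup.mk' R)).Normal :=
    Normal.map ‹_› _ (QuotientGroup.mk'_surjective R)
  have : C.Normal := by rw [hC]; infer_instance
  have hCS : ⁅C, S⁆ ≤ R := commutator_le_iff_le_comap_centralizer.mpr le_rfl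
  refine (commutator_le_iff_le_comap_centralizer.mp hX : X ≤ C).trans ?_
  obtain ⟨n, hn⟩ := Group.IsSolvable.solvable (G := G)
  -- Climb the derived series from its trivial term. If `D` is the next intersection, then ⁅D, D⁆ ≤
  -- S by induction and ⁅S, C⁆ ≤ R, so the third lower central term of `D` lies in `R` and `D` is a
  -- normal subgroup of length at most `k + 1`.
  have key (i : ℕ) : C ⊓ derivedSeries G (n - i) ≤ S := by
    induction i with
    | zero =>
      rw [Nat.sub_zero, hn, inf_bot_eq]
      exact bot_le
    | succ i ih =>
      rcases Nat.lt_or_ge i n with hi | hi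
      · have hs : n - i = n - (i + 1) + 1 := by omega
        rw [hs, derivedSeries_succ] at ih
        set D := C ⊓ derivedSeries G (n - (i + 1)) with hD
        have := derivedSeries_normal G (n - (i + 1))
        have : D.Normal := by rw [hD]; infer_instance
        have hDC : D ≤ C := inf_le_left
        have h1 : ⁅D, D⁆ ≤ S :=
          (le_inf ((commutator_le_left D D).trans hDC)
            (commutator_mono inf_le_right inf_le_right)).trans ih
        refine le_radical (mem_nilpotentLengthLE_succ (radical_mem_nilpotentLengthLE k) ?_)
        refine (nilpotentResidual_le_lowerCentralSeries D 2).trans ?_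
        refine (commutator_mono (h1 : D.lowerCentralSeries 1 ≤ S) hDC).trans ?_
        rw [commutator_comm]
        exact hCS
      · rwa [Nat.sub_eq_zero_of_le (hi.trans i.le_succ), ← Nat.sub_eq_zero_of_le hi]
  have := key n
  rwa [Nat.sub_self, derivedSeries_zero, inf_top_eq] at this

/-- Let X be the residual of `W` and S the larger radical. X ⊓ S is normal in S and has length at
most `k`, so it lies in the smaller radical. It contains ⁅X, S⁆, so self-centralization gives X ≤ S,
whence X = X ⊓ S. -/
theorem nilpotentResidual_le_radical_of_radical_le {k : ℕ} {W : Subgroup G}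
    (hRW : radical (nilpotentLengthLE G (k + 1)) ≤ W) (hW : W ∈ nilpotentLengthLE G (k + 1)) :
    nilpotentResidual W ≤ radical (nilpotentLengthLE G k) := by
  have hX := nilpotentResidual_mem_nilpotentLengthLE hW
  have hnorm : W ≤ normalizer (nilpotentResidual W : Set G) :=
    le_normalizer.trans (normalizer_le_normalizer_nilpotentResidual_iterate W 1)
  set X := nilpotentResidual W
  set S := radical (nilpotentLengthLE G (k + 1)) with hS
  have hSn : S.Normal := radical_normal _
  have hXS : X ⊓ S ≤ radical (nilpotentLengthLE G k) := by
    refine le_radical_of_isSubnormal (K := S) hSn.isSubnormal inf_le_right ?_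
      (mem_nilpotentLengthLE_of_le inf_le_left hX)
    rw [le_normalizer_iff_commutator_le_right]
    exact le_inf ((commutator_mono le_rfl inf_le_left).trans
      (le_normalizer_iff_commutator_le_right.mp (hRW.trans hnorm))) (commutator_le_left _ _)
  have hle : X ≤ S := by
    refine le_radical_of_commutator_le (le_trans (le_inf ?_ ?_) hXS)
    · exact le_normalizer_iff_commutator_le_left.mp (hRW.trans hnorm)
    · exact commutator_le_right _ _
  rwa [inf_eq_left.mpr hle] at hXS

theorem nilpotentResidual_le_radical_of_isSubnormal {k : ℕ} {K W : Subgroup G}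
    (hK : K.IsSubnormal) (hWK : W ≤ K) (hRW : radical (nilpotentLengthLE G (k + 1)) ⊓ K ≤ W)
    (hW : W ∈ nilpotentLengthLE G (k + 1)) :
    nilpotentResidual W ≤ radical (nilpotentLengthLE G k) := by
  have h1 : radical (nilpotentLengthLE K (k + 1)) ≤ W.subgroupOf K := by
    refine map_le_iff_le_comap.mp ((le_inf ?_ (map_subtype_le _)).trans hRW)
    exact map_subtype_radical_le _ hK
  have h2 : W.subgroupOf K ∈ nilpotentLengthLE K (k + 1) := by
    rw [mem_nilpotentLengthLE_iff] at *
    rwa [← map_subtype_inj, map_nilpotentResidual_iterate, map_subgroupOf_eq_of_le hWK,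
      Subgroup.map_bot]
  have h3 := map_mono (f := K.subtype) (nilpotentResidual_le_radical_of_radical_le h1 h2)
  rw [map_nilpotentResidual, map_subgroupOf_eq_of_le hWK] at h3
  exact h3.trans (map_subtype_radical_le _ hK)

end Soluble

/-! ### Comparing injectors of G and of G/R -/

section Injector

variable {G : Type*} [Group G] [Finite G]

theorem map_mk'_mem_nilpotentSubgroups_iff {R H : Subgroup G} [R.Normal] :
    H.map (QuotientGroup.mk' R) ∈ nilpotentSubgroups (G ⧸ R) ↔ nilpotentResidual H ≤ R := by
  refine (isNilpotent_iff_nilpotentResidual_eq_bot _).trans ?_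
  rw [← map_nilpotentResidual, Subgroup.map_eq_bot_iff, QuotientGroup.ker_mk']

omit [Finite G] in
theorem IsInjector.mem {F : Set (Subgroup G)} {V : Subgroup G} (hV : IsInjector F V) : V ∈ F := by
  have := (hV ⊤ IsSubnormal.top).prop.2
  rwa [inf_top_eq] at this

omit [Finite G] in
theorem IsInjector.le_of_normal {F : Set (Subgroup G)} {V N : Subgroup G} (hV : IsInjector F V)
    [hn : N.Normal] (hN : N ∈ F) : N ≤ V :=
  ((hV N hn.isSubnormal).le_of_ge ⟨le_rfl, hN⟩ inf_le_right).trans inf_le_left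

omit [Finite G] in
theorem map_inf_comap {H : Type*} [Group H] (f : G →* H) (V : Subgroup G) (K : Subgroup H) :
    (V ⊓ K.comap f).map f = V.map f ⊓ K := by
  apply le_antisymm
  · exact le_inf (map_mono inf_le_left) (map_le_iff_le_comap.mpr inf_le_right)
  · rintro _ ⟨⟨x, hx, rfl⟩, hk⟩
    exact ⟨x, ⟨hx, hk⟩, rfl⟩

variable [Group.IsSolvable G]

theorem isInjector_nilpotentLengthLE_iff (k : ℕ) (V : Subgroup G) :
    IsInjector (nilpotentLengthLE G (k + 1)) V ↔
      IsNilpotentInjectorMod (radical (nilpotentLengthLE G k)) V := by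
  have hR := radical_mem_nilpotentLengthLE (G := G) k
  have hRS := radical_le_radical_succ (G := G) k
  have hT := @nilpotentResidual_le_radical_of_isSubnormal G _ _ _ k
  have hSres := nilpotentResidual_radical_le (G := G) k
  have hSmem := radical_mem_nilpotentLengthLE (G := G) (k + 1)
  set R := radical (nilpotentLengthLE G k) with hRdef
  set S := radical (nilpotentLengthLE G (k + 1)) with hSdef
  have hSn : S.Normal := radical_normal _
  set π := QuotientGroup.mk' R with hπ
  have hsurj : Function.Surjective π := QuotientGroup.mk'_surjective R
  have hker : π.ker = R := QuotientGroup.ker_mk' R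
  constructor
  · intro hV
    have hSV : S ≤ V := hV.le_of_normal hSmem
    have hVres : nilpotentResidual V ≤ R :=
      hT IsSubnormal.top le_top (inf_le_left.trans hSV) hV.mem
    refine ⟨hRS.trans hSV, fun K hK => ⟨⟨inf_le_right, ?_⟩, ?_⟩⟩
    · rw [← map_inf_comap]
      exact map_mk'_mem_nilpotentSubgroups_iff.mpr
        ((nilpotentResidual_mono inf_le_left).trans hVres)
    · rintro U ⟨hUK, hU⟩ hle
      have hmap : (U.comap π).map π = U := map_comap_eq_self_of_surjective hsurj U
      rw [← hmap] at hU
      have hUmem : U.comap π ∈ nilpotentLengthLE G (k + 1) :=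
        mem_nilpotentLengthLE_succ hR (map_mk'_mem_nilpotentSubgroups_iff.mp hU)
      rw [← map_inf_comap, map_le_iff_le_comap] at hle
      have := (hV (K.comap π) (hK.comap π)).le_of_ge ⟨comap_mono hUK, hUmem⟩ hle
      rw [← hmap, ← map_inf_comap]
      exact map_mono this
  · rintro ⟨hRV, hV⟩
    have hVmem : V ∈ nilpotentLengthLE G (k + 1) :=
      mem_nilpotentLengthLE_succ hR (map_mk'_mem_nilpotentSubgroups_iff.mp hV.mem)
    -- The image of `S` is a normal nilpotent subgroup of the quotient, hence lies in every
    -- nilpotent injector; `R ≤ V` lets this be pulled back.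
    have hSV : S ≤ V := by
      have : (S.map π).Normal := hSn.map π hsurj
      have h := hV.le_of_normal (map_mk'_mem_nilpotentSubgroups_iff.mpr hSres)
      rwa [map_le_iff_le_comap, comap_map_eq_self (hker.le.trans hRV)] at h
    refine fun K hK => ⟨⟨inf_le_right, mem_nilpotentLengthLE_of_le inf_le_left hVmem⟩, ?_⟩
    rintro W ⟨hWK, hW⟩ (hle : V ⊓ K ≤ W)
    have hWres : nilpotentResidual W ≤ R := hT hK hWK ((inf_le_inf_right K hSV).trans hle) hW
    refine le_inf ?_ hWK
    -- Since `R ≤ V`, an element of `K` congruent mod `R` to an element of `V` is itself in `V`.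
    have hVK : V.map π ⊓ K.map π ≤ W.map π := by
      rintro _ ⟨⟨v, hv, rfl⟩, x, hx, hxv⟩
      have hxV : x ∈ V := by
        have hr : x⁻¹ * v ∈ R := QuotientGroup.eq.mp hxv
        have := mul_mem hv (inv_mem (hRV hr))
        simpa using this
      exact ⟨x, hle ⟨hxV, hx⟩, hxv⟩
    have h := (hV (K.map π) (hK.map hsurj)).le_of_ge
      ⟨map_mono hWK, map_mk'_mem_nilpotentSubgroups_iff.mpr hWres⟩ hVK
    have h' : W.map π ≤ V.map π := h.trans inf_le_left
    rwa [map_le_iff_le_comap, comap_map_eq_self (hker.le.trans hRV)] at h'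

omit [Finite G] [Group.IsSolvable G] in
theorem isNilpotentInjectorMod_congr {R R' V : Subgroup G} [R.Normal] [R'.Normal] (h : R = R') :
    IsNilpotentInjectorMod R V ↔ IsNilpotentInjectorMod R' V := by
  subst h
  rfl

end Injector

end FittingTheory

theorem corollary4p6 {G : Type*} [Group G] [Finite G] [Group.IsSolvable G] :
    (∀ k : ℕ, 1 ≤ k →
      FittingTheory.IsFittingSet (FittingTheory.nilpotentLengthLE G k) ∧
      {V : Subgroup G | FittingTheory.IsInjector (FittingTheory.nilpotentLengthLE G k) V} =
        {V : Subgroup G | FittingTheory.IsNilpotentInjectorMod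
          (FittingTheory.radical (FittingTheory.nilpotentLengthLE G (k - 1))) V}) ∧
    (∀ V : Subgroup G,
      FittingTheory.IsInjector (FittingTheory.nilpotentLengthLE G 2) V ↔
        FittingTheory.IsNilpotentInjectorMod (FittingTheory.fittingSubgroup G) V) := by

  refine ⟨fun k hk => ⟨FittingTheory.isFittingSet_nilpotentLengthLE k, ?_⟩, fun V => ?_⟩
  · obtain ⟨j, rfl⟩ := Nat.exists_eq_add_of_le' hk
    exact Set.ext fun V => FittingTheory.isInjector_nilpotentLengthLE_iff j V
  · refine (FittingTheory.isInjector_nilpotentLengthLE_iff 1 V).trans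
      (FittingTheory.isNilpotentInjectorMod_congr ?_)
    rw [FittingTheory.nilpotentLengthLE_one]
    rfl
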